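/- \textbf{Theorem.} Let $P\subset\mathbb R^2$ be a (closed, filled, nondegenerate) square with boundary $\partial P$. An input is a finite sequence $S=((s_1,d_1),\dots,(s_n,d_n))$ with $n\ge 1$, $0=s_1\le s_2\le\dots\le s_n$ and $d_i>s_i$; point $i$ arrives at time $s_i$ and departs at time $d_i$. Put $T=\max_i d_i$. For locations $X=(X_1,\dots,X_n)\in P^n$ and $0\le t\le T$ let $$d_{\min}(t;X)=\min\{\mathrm{dis}(X_i,\partial P),\ \mathrm{dis}(X_i,X_j)\ :\ i\ne j,\ s_i\le t\le d_i,\ s_j\le t\le d_j\}$$ be the minimum Euclidean distance between two points present at time $t$, or between a point present at time $t$ and the boundary (times at which no point is present are disregarded). The all-time worst-case (ATWC) value of $X$ is $\min_{0\le t\le T} d_{\min}(t;X)$, and $OPT_A(S;P)=\max_{X\in P^n}\min_{0\le t\le T}d_{\min}(t;X)$. A (deterministic, possibly computationally unbounded) online algorithm chooses $X_i\in P$ upon the arrival of point $i$, knowing only the arrivals of the points $1,\dots,i$ and the departures that have occurred so far, but neither the future events nor $n$. It achieves competitive ratio $\sigma$ if on every input $S$ its ATWC value is at least $OPT_A(S;P)/\sigma$.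 No online algorithm achieves a competitive ratio $$\sigma<\sqrt{\frac{2(2\ln 2-1)\pi}{\sqrt 3}}$$ for the ATWC dispersion problem in $P$. Moreover $1.183<\sqrt{2(2\ln 2-1)\pi/\sqrt3}<1.184$; in particular, no online algorithm achieves a competitive ratio better than $1.183$. -/

import Mathlib

open scoped ENNReal

noncomputable section

namespace Dispersion

/-- The Euclidean plane. -/
abbrev Plane : Type := EuclideanSpace ℝ (Fin 2)

/-- `P` is a closed (filled, nondegenerate) square in the plane, of arbitrary size, position and
orientation: `p` is a corner, `u` and `v` are the two sides that start in `p`. -/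
def IsFilledSquare (P : Set Plane) : Prop :=
  ∃ p u v : Plane, u ≠ 0 ∧ ‖u‖ = ‖v‖ ∧ inner ℝ u v = 0 ∧
    P = {x | ∃ a ∈ Set.Icc (0 : ℝ) 1, ∃ b ∈ Set.Icc (0 : ℝ) 1, x = p + a • u + b • v}

/-- An input of the problem: finitely many (at least one) points, listed by arrival;
point `i` arrives at time `arr i` and departs at time `dep i > arr i`,
and the first arrival is at time `0`. -/
structure Schedule where
  n : ℕ
  n_pos : 0 < n
  arr : Fin n → ℝ
  dep : Fin n → ℝ
  arr_lt_dep : ∀ i, arr i < dep i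
  arr_mono : Monotone arr
  arr_first : arr ⟨0, n_pos⟩ = 0

namespace Schedule

/-- The last departure time. -/
def horizon (S : Schedule) : ℝ := ⨆ i, S.dep i

/-- Point `i` is present at time `t`. -/
def Present (S : Schedule) (t : ℝ) (i : Fin S.n) : Prop := S.arr i ≤ t ∧ t ≤ S.dep i

end Schedule

/-- The minimum distance at time `t`: the least of the distances from a present point to the
boundary of `P` and of the distances between two different present points
(`∞` if no point is present, so that such times do not matter). -/
def dMin (P : Set Plane) (S : Schedule) (X : Fin S.n → P) (t : ℝ) : ℝ≥0∞ :=
  ⨅ (i : Fin S.n) (_ : S.Present t i),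
    min (Metric.infEDist (X i : Plane) (frontier P))
      (⨅ (j : Fin S.n) (_ : S.Present t j ∧ j ≠ i), edist (X i : Plane) (X j : Plane))

/-- The all-time worst-case value of the locations `X`. -/
def atwcValue (P : Set Plane) (S : Schedule) (X : Fin S.n → P) : ℝ≥0∞ :=
  ⨅ t ∈ Set.Icc 0 S.horizon, dMin P S X t

/-- The offline (ex-post) optimum of the all-time worst-case problem. -/
def optA (P : Set Plane) (S : Schedule) : ℝ≥0∞ := ⨆ X : Fin S.n → P, atwcValue P S X

/-- A (deterministic, computationally unbounded) online algorithm. The location of point `i` is a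
function of what has happened until its arrival: the arrival times of the points `0, …, i`, and,
for each earlier point, its departure time if it has departed already (`none` otherwise). -/
structure OnlineAlgorithm (P : Set Plane) where
  place : (i : ℕ) → (Fin (i + 1) → ℝ) → (Fin i → Option ℝ) → P

namespace OnlineAlgorithm

open Classical in
/-- The locations that the algorithm chooses on the input `S`. -/
def run {P : Set Plane} (A : OnlineAlgorithm P) (S : Schedule) (i : Fin S.n) : P :=
  A.place i
    (fun j => S.arr ⟨j, by omega⟩)
    (fun j =>
      if S.dep ⟨j, by omega⟩ ≤ S.arr i then some (S.dep ⟨j, by omega⟩) else none)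

/-- The algorithm has competitive ratio (at most) `σ` for the all-time worst-case problem:
on every input its value is at least the offline optimum divided by `σ`. -/
def IsCompetitive {P : Set Plane} (A : OnlineAlgorithm P) (σ : ℝ) : Prop :=
  ∀ S : Schedule, optA P S ≤ ENNReal.ofReal σ * atwcValue P S (A.run S)

end OnlineAlgorithm

end Dispersion

end

namespace Dispersion

open MeasureTheory Metric

/-! The adversary releases `k` points at time 0 and keeps them all until time 1. The algorithm does
not see `k`, so it is committed to a single infinite sequence of locations, every prefix of which
must compete with the optimum for its length.

With `a = √3 / 2` and side length `L`, a triangular lattice shows that the optimum for `k` points is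
at least about `L / √(a k)` (`exists_separated_stdSquare`). Hence the first `k` locations keep
distance about `κ / √k` from each other and from the boundary, where `κ = L / (σ √a)`
(`OnlineAlgorithm.IsCompetitive.separated`).

All prefixes of length between `m` and `4m` are exploited at once by disks of unequal size
(`area_bound`): radius `κ / (2√m)` around each of the first `m` points, then `κ / √(i + 1) - κ /
(2√m)` around point `i`, which reaches 0 at `i + 1 = 4m`. No disk is larger than `κ / (2√m)`, so a
later disk and any earlier one have radii summing to at most `κ / √(i + 1)`: they are disjoint. The
sum of the squared radii tends to `κ² (1/4 + ∫ (1/√x - 1/(2√m))² dx)` over `[m, 4m]`, that is `κ² (2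
log 2 - 1)`. The total disk area is at most `L²`, so `π (2 log 2 - 1) ≤ a σ²`. -/

/-! ### Squares, disks and area -/

/-- The axis-parallel square with corner `0` and side length `L`. -/
def stdSquare (L : ℝ) : Set Plane := {x | x 0 ∈ Set.Icc 0 L ∧ x 1 ∈ Set.Icc 0 L}

lemma volume_stdSquare {L : ℝ} (hL : 0 ≤ L) : volume (stdSquare L) = ENNReal.ofReal (L ^ 2) := by
  have h : stdSquare L
      = (WithLp.ofLp : Plane → Fin 2 → ℝ) ⁻¹' (Set.Icc (fun _ => 0) (fun _ => L)) := by
    ext x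
    simp only [stdSquare, Set.mem_ofPred_eq, Set.mem_preimage, Set.mem_Icc, Pi.le_def,
      Fin.forall_fin_two]
    tauto
  rw [h, (PiLp.volume_preserving_ofLp (Fin 2)).measure_preimage
    measurableSet_Icc.nullMeasurableSet, Real.volume_Icc_pi]
  simp [pow_two, ENNReal.ofReal_mul hL]

/-- A filled square is the preimage of an axis-parallel one under an isometry. -/
lemma IsFilledSquare.exists_isometryEquiv {P : Set Plane} (hP : IsFilledSquare P) :
    ∃ (L : ℝ) (e : Plane ≃ᵢ Plane), 0 < L ∧ MeasurePreserving e ∧ P = e ⁻¹' stdSquare L := by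
  obtain ⟨p, u, v, hu, huv, hinner, rfl⟩ := hP
  have hL : 0 < ‖u‖ := norm_pos_iff.mpr hu
  have hon : Orthonormal ℝ ((Set.univ : Set (Fin 2)).domRestrict
      ![(‖u‖⁻¹ : ℝ) • u, (‖u‖⁻¹ : ℝ) • v]) := by
    have hon' : Orthonormal ℝ ![(‖u‖⁻¹ : ℝ) • u, (‖u‖⁻¹ : ℝ) • v] := by
      refine ⟨fun i => ?_, fun i j hij => ?_⟩
      · fin_cases i
        · simp [norm_smul, hL.ne']
        · simp [norm_smul, ← huv, hL.ne']
      · fin_cases i <;> fin_cases j <;>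
          simp_all [inner_smul_left, inner_smul_right, real_inner_comm]
    exact hon'.comp _ Subtype.val_injective
  obtain ⟨b, hb⟩ := hon.exists_orthonormalBasis_extension_of_card_eq (by simp)
  have hb0 : b 0 = (‖u‖⁻¹ : ℝ) • u := hb 0 trivial
  have hb1 : b 1 = (‖u‖⁻¹ : ℝ) • v := hb 1 trivial
  have hu' : u = ‖u‖ • b 0 := by rw [hb0, smul_smul, mul_inv_cancel₀ hL.ne', one_smul]
  have hv' : v = ‖u‖ • b 1 := by rw [hb1, smul_smul, mul_inv_cancel₀ hL.ne', one_smul]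
  refine ⟨‖u‖, (IsometryEquiv.subRight p).trans b.repr.toIsometryEquiv, hL,
    b.measurePreserving_repr.comp (measurePreserving_sub_right volume p), ?_⟩
  ext x
  have hx : x - p = (b.repr (x - p) 0) • b 0 + (b.repr (x - p) 1) • b 1 := by
    have := b.sum_repr (x - p)
    rw [Fin.sum_univ_two] at this
    exact this.symm
  simp only [Set.mem_ofPred_eq, Set.mem_preimage, stdSquare, IsometryEquiv.trans_apply]
  change _ ↔ b.repr (x - p) 0 ∈ _ ∧ b.repr (x - p) 1 ∈ _
  constructor
  · rintro ⟨s, hs, t, ht, h⟩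
    have h' : x - p = (s * ‖u‖) • b 0 + (t * ‖u‖) • b 1 := by
      rw [h, mul_smul, mul_smul, ← hu', ← hv']; abel
    have h0 : b.repr (x - p) 0 = s * ‖u‖ := by
      rw [h']; simp
    have h1 : b.repr (x - p) 1 = t * ‖u‖ := by
      rw [h']; simp
    rw [h0, h1]
    exact ⟨⟨by have := hs.1; positivity, by nlinarith [hs.2]⟩,
      ⟨by have := ht.1; positivity, by nlinarith [ht.2]⟩⟩
  · rintro ⟨h0, h1⟩
    refine ⟨b.repr (x - p) 0 / ‖u‖, ⟨div_nonneg h0.1 hL.le, (div_le_one hL).2 h0.2⟩,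
      b.repr (x - p) 1 / ‖u‖, ⟨div_nonneg h1.1 hL.le, (div_le_one hL).2 h1.2⟩, ?_⟩
    have h2 : (b.repr (x - p) 0 / ‖u‖) • u = (b.repr (x - p) 0) • b 0 := by
      rw [hb0, smul_smul, div_eq_mul_inv]
    have h3 : (b.repr (x - p) 1 / ‖u‖) • v = (b.repr (x - p) 1) • b 1 := by
      rw [hb1, smul_smul, div_eq_mul_inv]
    rw [h2, h3, add_assoc, ← hx]
    abel

/-- A ball around a point of `P` that does not reach the boundary of `P` is contained in `P`. -/
lemma ball_subset_of_le_infEDist_frontier {P : Set Plane} {x : Plane} {r : ℝ} (hx : x ∈ P)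
    (hr : ENNReal.ofReal r ≤ infEDist x (frontier P)) : ball x r ⊆ P := by
  rcases le_or_gt r 0 with h0 | h0
  · simp [ball_eq_empty.2 h0]
  have hfr : ∀ y ∈ ball x r, y ∉ frontier P := fun y hy hyf => by
    have h1 := hr.trans (infEDist_le_edist_of_mem hyf)
    rw [edist_dist, ENNReal.ofReal_le_ofReal_iff dist_nonneg, dist_comm] at h1
    exact (mem_ball.1 hy).not_ge h1
  have hsub : ball x r ⊆ interior P := by
    -- The ball is connected and misses the frontier, so it cannot meet both the interior of `P` and
    -- the complement of its closure.
    refine (convex_ball x r).isPreconnected.subset_left_of_subset_union isOpen_interior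
      (isClosed_closure (s := P)).isOpen_compl ?_ (fun y hy => ?_) ⟨x, mem_ball_self h0, ?_⟩
    · exact Set.disjoint_compl_right_iff_subset.2 (interior_subset.trans subset_closure)
    · by_contra hcon
      simp only [Set.mem_union, Set.mem_compl_iff, not_or, not_not] at hcon
      exact hfr y hy ⟨hcon.2, hcon.1⟩
    · by_contra hcon
      exact hfr x (mem_ball_self h0) ⟨subset_closure hx, hcon⟩
  exact hsub.trans interior_subset

lemma le_infEDist_frontier_of_ball_subset {P : Set Plane} {x : Plane} {r : ℝ}
    (h : ball x r ⊆ P) : ENNReal.ofReal r ≤ infEDist x (frontier P) := by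
  refine le_infEDist.2 fun y hy => ?_
  rw [edist_dist]
  refine ENNReal.ofReal_le_ofReal (not_lt.1 fun hlt => hy.2 ?_)
  exact interior_maximal h isOpen_ball (mem_ball'.2 hlt)

/-- The total area of disjoint disks in a set is at most the area of the set. -/
lemma sum_pi_mul_sq_le {ι : Type*} {P : Set Plane} {V : ℝ} (hV : 0 ≤ V)
    (hP : volume P ≤ ENNReal.ofReal V) (s : Finset ι) (x : ι → Plane) (r : ι → ℝ)
    (hr : ∀ i ∈ s, 0 ≤ r i) (hsub : ∀ i ∈ s, ball (x i) (r i) ⊆ P)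
    (hd : ∀ i ∈ s, ∀ j ∈ s, i ≠ j → r i + r j ≤ dist (x i) (x j)) :
    Real.pi * ∑ i ∈ s, r i ^ 2 ≤ V := by
  have h1 : ∑ i ∈ s, volume (ball (x i) (r i)) ≤ ENNReal.ofReal V := by
    rw [← measure_biUnion_finset (fun i hi j hj hij => ball_disjoint_ball (hd i hi j hj hij))
      (fun _ _ => measurableSet_ball)]
    exact (measure_mono (Set.iUnion₂_subset hsub)).trans hP
  have h2 : ∑ i ∈ s, volume (ball (x i) (r i))
      = ENNReal.ofReal (Real.pi * ∑ i ∈ s, r i ^ 2) := by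
    rw [Finset.mul_sum, ENNReal.ofReal_sum_of_nonneg (fun i _ => by positivity)]
    refine Finset.sum_congr rfl fun i hi => ?_
    rw [EuclideanSpace.volume_ball_fin_two, mul_comm, ENNReal.ofReal_mul Real.pi_pos.le,
      ENNReal.ofReal_pow (hr i hi)]
  rw [h2] at h1
  exact (ENNReal.ofReal_le_ofReal_iff hV).1 h1

/-! ### Lower bound on the optimum: the triangular lattice -/

/-- The point in row `r` and column `c` of the triangular lattice with spacing `δ`, shifted by
`(δ, δ)`; odd rows are indented by `δ / 2`. -/
noncomputable def hexPoint (δ : ℝ) (r c : ℕ) : Plane :=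
  !₂[δ * (1 + c + (r % 2 : ℕ) / 2), δ * (1 + r * (Real.sqrt 3 / 2))]

/-- In units of `δ / 2`, a lattice difference has squared length `x ^ 2 + 3 * y ^ 2`, with `y` the
row difference and `x` of the same parity because odd rows are indented by half a spacing. -/
lemma four_le_sq_add_three_mul_sq {x y : ℤ} (hpar : x % 2 = y % 2) (h : ¬(x = 0 ∧ y = 0)) :
    4 ≤ x ^ 2 + 3 * y ^ 2 := by
  rcases eq_or_ne y 0 with rfl | hy
  · have hx : x ≠ 0 := fun hx => h ⟨hx, rfl⟩
    obtain ⟨z, rfl⟩ : (2 : ℤ) ∣ x := by omega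
    have : z ≠ 0 := by rintro rfl; simp at hx
    nlinarith [Int.one_le_abs this, sq_abs z]
  · rcases eq_or_ne x 0 with rfl | hx
    · obtain ⟨z, rfl⟩ : (2 : ℤ) ∣ y := by omega
      have : z ≠ 0 := by rintro rfl; simp at hy
      nlinarith [Int.one_le_abs this, sq_abs z]
    · nlinarith [Int.one_le_abs hx, sq_abs x, Int.one_le_abs hy, sq_abs y]

lemma le_dist_hexPoint {δ : ℝ} {r c r' c' : ℕ} (h : (r, c) ≠ (r', c')) :
    δ ≤ dist (hexPoint δ r c) (hexPoint δ r' c') := by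
  have hint : (4 : ℤ) ≤ (2 * ((c : ℤ) - c') + ((r % 2 : ℕ) - (r' % 2 : ℕ))) ^ 2
      + 3 * ((r : ℤ) - r') ^ 2 := by
    refine four_le_sq_add_three_mul_sq (by omega) fun h0 => h ?_
    have : r = r' := by omega
    subst this
    have : c = c' := by omega
    rw [this]
  have hreal : (4 : ℝ) ≤ (2 * ((c : ℝ) - c') + (((r % 2 : ℕ) : ℝ) - (r' % 2 : ℕ))) ^ 2
      + 3 * ((r : ℝ) - r') ^ 2 := by exact_mod_cast hint
  rw [EuclideanSpace.dist_eq]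
  refine Real.le_sqrt_of_sq_le ?_
  simp only [hexPoint, Fin.sum_univ_two, Real.dist_eq, sq_abs, Matrix.cons_val_zero,
    Matrix.cons_val_one]
  have h3 : Real.sqrt 3 ^ 2 = 3 := Real.sq_sqrt (by norm_num)
  have key : (δ * (1 + c + ((r % 2 : ℕ) : ℝ) / 2) - δ * (1 + c' + ((r' % 2 : ℕ) : ℝ) / 2)) ^ 2
      + (δ * (1 + r * (Real.sqrt 3 / 2)) - δ * (1 + r' * (Real.sqrt 3 / 2))) ^ 2
      = δ ^ 2 / 4 * ((2 * ((c : ℝ) - c') + (((r % 2 : ℕ) : ℝ) - (r' % 2 : ℕ))) ^ 2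
      + Real.sqrt 3 ^ 2 * ((r : ℝ) - r') ^ 2) := by ring
  rw [key, h3]
  nlinarith [mul_le_mul_of_nonneg_left hreal (by positivity : 0 ≤ δ ^ 2 / 4)]

lemma ball_subset_stdSquare {L δ : ℝ} {x : Plane} (h0 : x 0 ∈ Set.Icc δ (L - δ))
    (h1 : x 1 ∈ Set.Icc δ (L - δ)) : ball x δ ⊆ stdSquare L := by
  intro y hy
  have hy' : ∀ i, |y i - x i| ≤ δ := fun i => by
    have := (PiLp.norm_apply_le (y - x) i)
    rw [← dist_eq_norm] at this
    exact this.trans (mem_ball.1 hy).le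
  have a0 := abs_le.1 (hy' 0)
  have a1 := abs_le.1 (hy' 1)
  exact ⟨⟨by linarith [h0.1], by linarith [h0.2]⟩, ⟨by linarith [h1.1], by linarith [h1.2]⟩⟩

/-- A square of side `L` holds `k` points that have mutual distance and distance to the boundary
at least `L / (√((√3 / 2) k) + 5 / 2)`. -/
lemma exists_separated_stdSquare {L : ℝ} (hL : 0 < L) (k : ℕ) :
    ∃ Y : Fin k → Plane,
      (∀ i, ball (Y i) (L / (Real.sqrt (Real.sqrt 3 / 2 * k) + 5 / 2)) ⊆ stdSquare L) ∧
      ∀ i j, i ≠ j → L / (Real.sqrt (Real.sqrt 3 / 2 * k) + 5 / 2) ≤ dist (Y i) (Y j) := by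
  set a : ℝ := Real.sqrt 3 / 2 with ha
  have ha0 : 0 < a := by positivity
  set q : ℝ := Real.sqrt (a * k) with hq
  have hq0 : 0 ≤ q := Real.sqrt_nonneg _
  -- In units of `δ`, the width needed is at most `q` for the columns, 1 for each of the two margins
  -- and `1 / 2` for the indentation; the height needs only `q + 2`.
  set δ : ℝ := L / (q + 5 / 2) with hδ
  have hδ0 : 0 < δ := by positivity
  have hLδ : L = δ * (q + 5 / 2) := by rw [hδ]; field_simp
  have hqk : q ^ 2 = a * k := Real.sq_sqrt (by positivity)
  set C : ℕ := ⌊q⌋₊ + 1 with hC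
  have hC1 : q ≤ C := by rw [hC]; push_cast; exact (Nat.lt_floor_add_one q).le
  set R : ℕ := ⌊q / a⌋₊ + 1 with hR
  have hR1 : q / a ≤ R := by rw [hR]; push_cast; exact (Nat.lt_floor_add_one _).le
  -- The grid is large enough because `q * (q / a) = k`.
  have hkRC : k ≤ C * R := by
    have h1 : (k : ℝ) ≤ C * R := by
      have : (k : ℝ) = q * (q / a) := by
        field_simp; rw [hqk]; ring
      rw [this]
      exact mul_le_mul hC1 hR1 (by positivity) (by positivity)
    exact_mod_cast h1
  have hrow : ∀ i : Fin k, ((i / C : ℕ) : ℝ) * a ≤ q := fun i => by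
    have h1 : (i / C : ℕ) < R := Nat.div_lt_of_lt_mul (i.2.trans_le hkRC)
    have h2 : (i / C : ℕ) ≤ ⌊q / a⌋₊ := by omega
    have h3 : ((i / C : ℕ) : ℝ) ≤ q / a := (Nat.le_floor_iff (by positivity)).1 h2
    rwa [le_div_iff₀ ha0] at h3
  have hcol : ∀ i : Fin k, ((i % C : ℕ) : ℝ) ≤ q := fun i => by
    have h1 : (i % C : ℕ) < C := Nat.mod_lt _ (by omega)
    exact (Nat.le_floor_iff hq0).1 (by omega)
  refine ⟨fun i => hexPoint δ (i / C) (i % C), fun i => ?_, fun i j hij => ?_⟩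
  · have hpar : (((i / C % 2 : ℕ) : ℕ) : ℝ) ≤ 1 := by
      have : (i / C % 2 : ℕ) ≤ 1 := by omega
      exact_mod_cast this
    have hpar0 : (0 : ℝ) ≤ ((i / C % 2 : ℕ) : ℝ) := Nat.cast_nonneg _
    have hc0 : (0 : ℝ) ≤ ((i % C : ℕ) : ℝ) := Nat.cast_nonneg _
    have hr0 : (0 : ℝ) ≤ ((i / C : ℕ) : ℝ) * a := by positivity
    apply ball_subset_stdSquare
    · simp only [hexPoint, Matrix.cons_val_zero]
      constructor
      · nlinarith
      · rw [hLδ]; nlinarith [hcol i]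
    · simp only [hexPoint, Matrix.cons_val_one, Matrix.cons_val_fin_one]
      constructor
      · rw [← ha]; nlinarith
      · rw [hLδ, ← ha]; nlinarith [hrow i]
  · apply le_dist_hexPoint
    intro h
    rw [Prod.mk.injEq] at h
    apply hij
    apply Fin.ext
    rw [← Nat.div_add_mod i C, ← Nat.div_add_mod j C, h.1, h.2]

lemma IsFilledSquare.exists_area_separated {P : Set Plane} (hP : IsFilledSquare P) :
    ∃ L : ℝ, 0 < L ∧ volume P ≤ ENNReal.ofReal (L ^ 2) ∧ ∀ k : ℕ, ∃ Y : Fin k → Plane,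
      (∀ i, ball (Y i) (L / (Real.sqrt (Real.sqrt 3 / 2 * k) + 5 / 2)) ⊆ P) ∧
      ∀ i j, i ≠ j → L / (Real.sqrt (Real.sqrt 3 / 2 * k) + 5 / 2) ≤ dist (Y i) (Y j) := by
  obtain ⟨L, e, hL, he, rfl⟩ := hP.exists_isometryEquiv
  refine ⟨L, hL, ?_, fun k => ?_⟩
  · rw [← volume_stdSquare hL.le]
    exact (he.measure_preimage_emb e.toHomeomorph.measurableEmbedding _).le
  · obtain ⟨Y, hY, hY'⟩ := exists_separated_stdSquare hL k
    refine ⟨fun i => e.symm (Y i), fun i x hx => hY i ?_, fun i j hij => ?_⟩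
    · have h1 : dist (e x) (e (e.symm (Y i))) < _ := (e.dist_eq x _).trans_lt (mem_ball.1 hx)
      rwa [e.apply_symm_apply] at h1
    · rw [e.symm.dist_eq]
      exact hY' i j hij

/-! ### The adversary: simultaneous arrivals of unknown number -/

/-- `k` points that arrive at time `0` and depart at time `1`. -/
def simultaneous (k : ℕ) (hk : 0 < k) : Schedule where
  n := k
  n_pos := hk
  arr _ := 0
  dep _ := 1
  arr_lt_dep _ := one_pos
  arr_mono := monotone_const
  arr_first := rfl

lemma le_optA_simultaneous {P : Set Plane} {k : ℕ} (hk : 0 < k) {δ : ℝ} (hδ : 0 < δ)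
    (Y : Fin k → Plane) (hY : ∀ i, ball (Y i) δ ⊆ P) (hY' : ∀ i j, i ≠ j → δ ≤ dist (Y i) (Y j)) :
    ENNReal.ofReal δ ≤ optA P (simultaneous k hk) := by
  refine le_iSup_of_le (fun i => ⟨Y i, hY i (mem_ball_self hδ)⟩) ?_
  refine le_iInf₂ fun t _ => le_iInf₂ fun i _ => le_min ?_ (le_iInf₂ fun j hj => ?_)
  · exact le_infEDist_frontier_of_ball_subset (hY i)
  · rw [edist_dist]
    exact ENNReal.ofReal_le_ofReal (hY' i j hj.2.symm)

lemma horizon_simultaneous {k : ℕ} (hk : 0 < k) : (simultaneous k hk).horizon = 1 := by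
  have : Nonempty (Fin (simultaneous k hk).n) := ⟨⟨0, hk⟩⟩
  exact ciSup_const

lemma atwcValue_simultaneous_le {P : Set Plane} {k : ℕ} (hk : 0 < k)
    (X : Fin (simultaneous k hk).n → P) (i : Fin (simultaneous k hk).n) :
    atwcValue P (simultaneous k hk) X ≤ infEDist (X i : Plane) (frontier P) ∧
    ∀ j, j ≠ i → atwcValue P (simultaneous k hk) X ≤ edist (X i : Plane) (X j) := by
  have hpres : ∀ j, (simultaneous k hk).Present 0 j := fun j => ⟨le_rfl, zero_le_one⟩
  have h0 : (0 : ℝ) ∈ Set.Icc 0 (simultaneous k hk).horizon := by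
    rw [horizon_simultaneous]; simp
  have h1 := (iInf₂_le (f := fun t _ => dMin P (simultaneous k hk) X t) (0 : ℝ) h0).trans
    (iInf₂_le i (hpres i))
  exact ⟨h1.trans (min_le_left _ _), fun j hj =>
    h1.trans ((min_le_right _ _).trans (iInf₂_le j ⟨hpres j, hj⟩))⟩

/-- The place of point `i` if the points `0, …, i` arrive at time `0` and none has departed. -/
def OnlineAlgorithm.simultaneousPlace {P : Set Plane} (A : OnlineAlgorithm P) (i : ℕ) : P :=
  A.place i (fun _ => 0) (fun _ => none)

/-- No departure (time 1) has occurred at any arrival (time 0), so the observed history carries no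
information about `k`. This independence of `k` is what lets one sequence face all prefix lengths.
-/
lemma OnlineAlgorithm.run_simultaneous {P : Set Plane} (A : OnlineAlgorithm P) {k : ℕ}
    (hk : 0 < k) (i : Fin (simultaneous k hk).n) :
    A.run (simultaneous k hk) i = A.simultaneousPlace i := by
  simp [OnlineAlgorithm.run, OnlineAlgorithm.simultaneousPlace, simultaneous, one_pos.not_ge]

lemma OnlineAlgorithm.IsCompetitive.separated {P : Set Plane} {A : OnlineAlgorithm P} {σ : ℝ}
    (hA : A.IsCompetitive σ) {k : ℕ} (hk : 0 < k) {δ : ℝ} (hδ : 0 < δ)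
    (Y : Fin k → Plane) (hY : ∀ i, ball (Y i) δ ⊆ P)
    (hY' : ∀ i j, i ≠ j → δ ≤ dist (Y i) (Y j)) :
    0 < σ ∧ ∀ i < k, ball (A.simultaneousPlace i : Plane) (δ / σ) ⊆ P ∧
      ∀ j < k, i ≠ j →
        δ / σ ≤ dist (A.simultaneousPlace i : Plane) (A.simultaneousPlace j) := by
  have h := (le_optA_simultaneous hk hδ Y hY hY').trans (hA (simultaneous k hk))
  -- For `σ ≤ 0` the factor `ENNReal.ofReal σ` is 0, contradicting the positive optimum.
  have hσ : 0 < σ := by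
    by_contra hσ
    rw [ENNReal.ofReal_of_nonpos (not_lt.1 hσ), zero_mul, nonpos_iff_eq_zero,
      ENNReal.ofReal_eq_zero] at h
    exact hδ.not_ge h
  have h' : ENNReal.ofReal (δ / σ)
      ≤ atwcValue P (simultaneous k hk) (A.run (simultaneous k hk)) := by
    rw [ENNReal.ofReal_div_of_pos hσ]
    exact ENNReal.div_le_of_le_mul' h
  refine ⟨hσ, fun i hi => ?_⟩
  obtain ⟨h1, h2⟩ := atwcValue_simultaneous_le hk (A.run (simultaneous k hk)) ⟨i, hi⟩
  rw [A.run_simultaneous hk] at h1 h2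
  refine ⟨ball_subset_of_le_infEDist_frontier (A.simultaneousPlace i).2 (h'.trans h1),
    fun j hj hij => ?_⟩
  have h3 := h'.trans (h2 ⟨j, hj⟩ (by simpa [Fin.ext_iff] using hij.symm))
  rw [A.run_simultaneous hk, edist_dist, ENNReal.ofReal_le_ofReal_iff dist_nonneg] at h3
  exact h3

/-! ### Sums of squared radii and the area bound -/

lemma log_sub_log_le_sum (m n : ℕ) :
    Real.log (m + n + 1) - Real.log (m + 1) ≤ ∑ i ∈ Finset.range n, 1 / ((m + i : ℝ) + 1) := by
  induction n with
  | zero => simp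
  | succ n ih =>
    rw [Finset.sum_range_succ]
    have hp : (0 : ℝ) < m + n + 1 := by positivity
    have hq : (0 : ℝ) < m + (n + 1) + 1 := by positivity
    have h := Real.log_le_sub_one_of_pos (div_pos hq hp)
    rw [Real.log_div hq.ne' hp.ne'] at h
    have h2 : ((m : ℝ) + (n + 1) + 1) / (m + n + 1) - 1 = 1 / ((m + n : ℝ) + 1) := by
      field_simp; ring
    push_cast
    linarith

/-- Telescoping of `1 / √(x + 1) ≤ 2 (√(x + 1) - √x)`, the integral comparison for `1 / √x`. -/
lemma sum_one_div_sqrt_le (m n : ℕ) :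
    ∑ i ∈ Finset.range n, 1 / Real.sqrt ((m + i : ℝ) + 1)
      ≤ 2 * (Real.sqrt (m + n) - Real.sqrt m) := by
  induction n with
  | zero => simp
  | succ n ih =>
    rw [Finset.sum_range_succ]
    have hs : 0 < Real.sqrt ((m + n : ℝ) + 1) := Real.sqrt_pos.2 (by positivity)
    have h1 : Real.sqrt ((m + n : ℝ) + 1) ^ 2 = m + n + 1 := Real.sq_sqrt (by positivity)
    have h2 : Real.sqrt (m + n : ℝ) ^ 2 = m + n := Real.sq_sqrt (by positivity)
    have h3 : 1 / Real.sqrt ((m + n : ℝ) + 1)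
        ≤ 2 * (Real.sqrt ((m + n : ℝ) + 1) - Real.sqrt (m + n)) := by
      rw [div_le_iff₀ hs]
      nlinarith [sq_nonneg (Real.sqrt ((m + n : ℝ) + 1) - Real.sqrt (m + n))]
    push_cast
    rw [← add_assoc]
    linarith

/-- The radii of the disjoint disks, scaled by `κ`. -/
noncomputable def diskRadius (m : ℕ) (κ : ℝ) (i : ℕ) : ℝ :=
  if i < m then κ / (2 * Real.sqrt m) else κ / Real.sqrt (i + 1) - κ / (2 * Real.sqrt m)

/-- In units of `κ ^ 2`, the equal disks contribute `1 / 4`. Expanding the square for the shrinking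
ones gives a harmonic sum, a cross term of at least `-2`, and `3 / 4`; the constants add up to `-1`.
-/
lemma sum_diskRadius_sq {m : ℕ} (hm : 0 < m) (κ : ℝ) :
    κ ^ 2 * (Real.log (4 * m + 1) - Real.log (m + 1) - 1)
      ≤ ∑ i ∈ Finset.range (4 * m), diskRadius m κ i ^ 2 := by
  set s := Real.sqrt m with hs
  have hm' : (0 : ℝ) < m := by exact_mod_cast hm
  have hs0 : 0 < s := Real.sqrt_pos.2 hm'
  have hs2 : s ^ 2 = m := Real.sq_sqrt hm'.le
  have hsplit : 4 * m = m + 3 * m := by ring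
  rw [hsplit, Finset.sum_range_add]
  have h1 : ∑ i ∈ Finset.range m, diskRadius m κ i ^ 2 = κ ^ 2 / 4 := by
    rw [Finset.sum_congr rfl (g := fun _ => (κ / (2 * s)) ^ 2)
      (fun i hi => by rw [diskRadius, if_pos (Finset.mem_range.1 hi)])]
    rw [Finset.sum_const, Finset.card_range, nsmul_eq_mul, ← hs2]
    field_simp
    ring
  have h2 : ∑ i ∈ Finset.range (3 * m), diskRadius m κ (m + i) ^ 2
      = κ ^ 2 * (∑ i ∈ Finset.range (3 * m), 1 / ((m + i : ℝ) + 1)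
        - (∑ i ∈ Finset.range (3 * m), 1 / Real.sqrt ((m + i : ℝ) + 1)) / s + 3 / 4) := by
    have h3 : (3 / 4 : ℝ) = ∑ i ∈ Finset.range (3 * m), 1 / (4 * s ^ 2) := by
      rw [Finset.sum_const, Finset.card_range, nsmul_eq_mul, hs2]
      push_cast
      field_simp
    rw [h3, Finset.sum_div, ← Finset.sum_sub_distrib, ← Finset.sum_add_distrib, Finset.mul_sum]
    refine Finset.sum_congr rfl fun i _ => ?_
    rw [diskRadius, if_neg (by omega)]
    push_cast
    rw [← hs]
    have ht : 0 < Real.sqrt ((m + i : ℝ) + 1) := Real.sqrt_pos.2 (by positivity)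
    have ht2 : (m + i : ℝ) + 1 = Real.sqrt ((m + i : ℝ) + 1) ^ 2 :=
      (Real.sq_sqrt (by positivity)).symm
    set t := Real.sqrt ((m + i : ℝ) + 1)
    rw [ht2]
    field_simp
    ring
  rw [h1, h2]
  have h4 := log_sub_log_le_sum m (3 * m)
  have h5 := sum_one_div_sqrt_le m (3 * m)
  have h6 : Real.sqrt (m + (3 * m : ℕ)) = 2 * s := by
    rw [Real.sqrt_eq_iff_mul_self_eq (by positivity) (by positivity), hs]
    push_cast
    nlinarith
  rw [h6, ← hs] at h5
  have h7 : (∑ i ∈ Finset.range (3 * m), 1 / Real.sqrt ((m + i : ℝ) + 1)) / s ≤ 2 := by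
    rw [div_le_iff₀ hs0]; linarith
  have h8 : (m : ℝ) + (3 * m : ℕ) + 1 = 4 * m + 1 := by push_cast; ring
  rw [h8] at h4
  have h9 := mul_le_mul_of_nonneg_left (a := κ ^ 2)
    (show Real.log (4 * m + 1) - Real.log (m + 1) - 1 - 1 / 4 ≤
      ∑ i ∈ Finset.range (3 * m), 1 / ((m + i : ℝ) + 1)
        - (∑ i ∈ Finset.range (3 * m), 1 / Real.sqrt ((m + i : ℝ) + 1)) / s + 3 / 4 by linarith)
    (by positivity)
  linarith

/-- If among the first `j + 1` points, for all `j + 1 ≥ m`, the distances are at least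
`κ / √(j + 1)`, then disks of decreasing radii around the first `4 m` points are disjoint. -/
lemma area_bound {P : Set Plane} {V : ℝ} (hV : 0 ≤ V) (hP : volume P ≤ ENNReal.ofReal V)
    (X : ℕ → Plane) {κ : ℝ} (hκ : 0 ≤ κ) {m : ℕ} (hm : 0 < m)
    (hball : ∀ i j : ℕ, i ≤ j → m ≤ j + 1 → ball (X i) (κ / Real.sqrt (j + 1)) ⊆ P)
    (hdist : ∀ i i' j : ℕ, i ≤ j → i' ≤ j → i ≠ i' → m ≤ j + 1 →
      κ / Real.sqrt (j + 1) ≤ dist (X i) (X i')) :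
    Real.pi * (κ ^ 2 * (Real.log (4 * m + 1) - Real.log (m + 1) - 1)) ≤ V := by
  have hm' : (0 : ℝ) < m := by exact_mod_cast hm
  have hs0 : 0 < Real.sqrt m := Real.sqrt_pos.2 hm'
  have hc0 : 0 ≤ κ / (2 * Real.sqrt m) := by positivity
  have h2c : κ / Real.sqrt m = κ / (2 * Real.sqrt m) + κ / (2 * Real.sqrt m) := by
    field_simp; ring
  have hpred : ((m - 1 : ℕ) : ℝ) + 1 = m := by
    rw [Nat.cast_sub hm]; simp
  have hanti : ∀ j : ℕ, m ≤ j + 1 → κ / Real.sqrt (j + 1) ≤ κ / Real.sqrt m := fun j hj => by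
    have : (m : ℝ) ≤ j + 1 := by exact_mod_cast hj
    gcongr
  refine (mul_le_mul_of_nonneg_left (sum_diskRadius_sq hm κ) Real.pi_pos.le).trans ?_
  have hpair : ∀ i j : ℕ, i < j → diskRadius m κ i + diskRadius m κ j ≤ dist (X i) (X j) := by
    intro i j hij
    rcases lt_or_ge j m with hj | hj
    · rw [diskRadius, diskRadius, if_pos (hij.trans hj), if_pos hj, ← h2c]
      -- Two of the first `m` points: the prefix of exactly `m` points ends at index `m - 1`.
      have := hdist i j (m - 1) (by omega) (by omega) hij.ne (by omega)
      rwa [hpred] at this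
    -- The later disk gives up `κ / (2√m)`, which covers the radius of any earlier disk, whether `i
    -- < m` or not.
    · have h := hdist i j j hij.le le_rfl hij.ne (by omega)
      rw [diskRadius, diskRadius, if_neg hj.not_gt]
      split_ifs with hi
      · linarith
      · have := hanti i (by omega)
        linarith
  refine sum_pi_mul_sq_le hV hP _ X _ (fun i hi => ?_) (fun i hi => ?_)
    (fun i _ j _ hij => ?_)
  · rw [diskRadius]
    split_ifs with h
    · exact hc0
    -- The cutoff `4 * m` is exactly where the shrinking radius would become negative.
    · have hi4 : (i : ℝ) + 1 ≤ 4 * m := by exact_mod_cast Finset.mem_range.1 hi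
      have h1 : Real.sqrt (i + 1) ≤ 2 * Real.sqrt m := by
        rw [Real.sqrt_le_left (by positivity), mul_pow, Real.sq_sqrt hm'.le]
        linarith
      rw [sub_nonneg]
      gcongr
  · rw [diskRadius]
    split_ifs with h
    · have := hball i (m - 1) (by omega) (by omega)
      rw [hpred] at this
      exact (ball_subset_ball (by linarith)).trans this
    · exact (ball_subset_ball (by linarith)).trans (hball i i le_rfl (by omega))
  · rcases lt_or_gt_of_ne hij with h | h
    · exact hpair i j h
    · rw [add_comm, dist_comm]; exact hpair j i h

/-! ### The limit and the numerical value -/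

open Filter Topology in
lemma tendsto_log_sub_log :
    Tendsto (fun m : ℕ => Real.log (4 * m + 1) - Real.log (m + 1) - 1) atTop
      (𝓝 (2 * Real.log 2 - 1)) := by
  -- This is `(4m + 1) / (m + 1)`, the argument of the combined logarithm.
  have h1 : Tendsto (fun m : ℕ => (4 : ℝ) - 3 * (1 / ((m : ℝ) + 1))) atTop (𝓝 4) := by
    simpa using (tendsto_one_div_add_atTop_nhds_zero_nat (𝕜 := ℝ)).const_mul 3 |>.const_sub 4
  have h2 := (h1.log (by norm_num)).sub_const 1
  have h4 : Real.log 4 = 2 * Real.log 2 := by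
    rw [show (4 : ℝ) = 2 ^ 2 by norm_num, Real.log_pow]; norm_num
  rw [h4] at h2
  refine h2.congr fun m => ?_
  have hm : (0 : ℝ) < m + 1 := by positivity
  rw [← Real.log_div (by positivity) hm.ne']
  congr 2
  field_simp
  ring

open Filter Topology in
lemma OnlineAlgorithm.IsCompetitive.sqrt_le {P : Set Plane} (hP : IsFilledSquare P)
    {A : OnlineAlgorithm P} {σ : ℝ} (hA : A.IsCompetitive σ) :
    Real.sqrt (2 * (2 * Real.log 2 - 1) * Real.pi / Real.sqrt 3) ≤ σ := by
  obtain ⟨L, hL, hvol, hY⟩ := hP.exists_area_separated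
  set a : ℝ := Real.sqrt 3 / 2 with ha
  have ha0 : 0 < a := by positivity
  have hsep : ∀ k : ℕ, 0 < k → 0 < σ ∧ ∀ i < k,
      ball (A.simultaneousPlace i : Plane) (L / (Real.sqrt (a * k) + 5 / 2) / σ) ⊆ P ∧
      ∀ j < k, i ≠ j → L / (Real.sqrt (a * k) + 5 / 2) / σ
        ≤ dist (A.simultaneousPlace i : Plane) (A.simultaneousPlace j) := fun k hk => by
    obtain ⟨Y, hY1, hY2⟩ := hY k
    exact hA.separated hk (by positivity) Y hY1 hY2
  have hσ : 0 < σ := (hsep 1 one_pos).1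
  have hbound : ∀ m : ℕ, 0 < m → Real.pi * (Real.log (4 * m + 1) - Real.log (m + 1) - 1)
      ≤ ((Real.sqrt a + 5 / 2 * (1 / Real.sqrt m)) * σ) ^ 2 := by
    intro m hm
    have hm' : (0 : ℝ) < m := by exact_mod_cast hm
    have hs0 : 0 < Real.sqrt m := Real.sqrt_pos.2 hm'
    set ρ : ℝ := (Real.sqrt a + 5 / 2 * (1 / Real.sqrt m)) * σ with hρ
    have hρ0 : 0 < ρ := by positivity
    -- For prefixes of length at least `m`, the additive loss `5 / 2` is at most `5 / 2 * √(j + 1) /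
    -- √m`. It is absorbed into `ρ`, giving the pure form `κ / √(j + 1)` with `κ = L / ρ`; the extra
    -- term in `ρ` vanishes as `m → ∞`.
    have hle : ∀ j : ℕ, m ≤ j + 1 → L / ρ / Real.sqrt (j + 1)
        ≤ L / (Real.sqrt (a * (j + 1 : ℕ)) + 5 / 2) / σ := fun j hj => by
      have hj' : (m : ℝ) ≤ j + 1 := by exact_mod_cast hj
      have h1 : Real.sqrt m ≤ Real.sqrt (j + 1) := Real.sqrt_le_sqrt hj'
      have h2 : 1 ≤ 1 / Real.sqrt m * Real.sqrt (j + 1) := by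
        rw [one_div_mul_eq_div]; exact (one_le_div hs0).2 h1
      rw [div_div, div_div]
      refine div_le_div_of_nonneg_left hL.le (by positivity) ?_
      push_cast
      rw [Real.sqrt_mul ha0.le]
      have h3 : ρ * Real.sqrt (j + 1) = (Real.sqrt a * Real.sqrt (j + 1)
          + 5 / 2 * (1 / Real.sqrt m * Real.sqrt (j + 1))) * σ := by rw [hρ]; ring
      rw [h3]
      exact mul_le_mul_of_nonneg_right (by linarith) hσ.le
    have h := area_bound (by positivity) hvol (fun i => (A.simultaneousPlace i : Plane))
      (κ := L / ρ) (by positivity) hm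
      (fun i j hij hj => (ball_subset_ball (hle j hj)).trans
        ((hsep (j + 1) (by omega)).2 i (by omega)).1)
      (fun i i' j hi hi' hne hj => (hle j hj).trans
        (((hsep (j + 1) (by omega)).2 i (by omega)).2 i' (by omega) hne))
    rw [← mul_assoc, mul_comm Real.pi, mul_assoc, div_pow, div_mul_eq_mul_div,
      div_le_iff₀ (by positivity)] at h
    exact le_of_mul_le_mul_left h (by positivity)
  have hlim1 := tendsto_log_sub_log.const_mul Real.pi
  have hlim2 : Tendsto (fun m : ℕ => ((Real.sqrt a + 5 / 2 * (1 / Real.sqrt m)) * σ) ^ 2) atTop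
      (𝓝 (((Real.sqrt a + 5 / 2 * 0) * σ) ^ 2)) := by
    have h0 : Tendsto (fun m : ℕ => 1 / Real.sqrt m) atTop (𝓝 0) := by
      simp only [one_div]
      exact (Real.tendsto_sqrt_atTop.comp tendsto_natCast_atTop_atTop).inv_tendsto_atTop
    exact (((h0.const_mul _).const_add _).mul_const _).pow 2
  have hfin := le_of_tendsto_of_tendsto hlim1 hlim2
    ((eventually_gt_atTop 0).mono fun m hm => hbound m hm)
  rw [mul_zero, add_zero, mul_pow, Real.sq_sqrt ha0.le] at hfin
  rw [Real.sqrt_le_left hσ.le, div_le_iff₀ (by positivity)]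
  rw [ha] at hfin
  linarith

end Dispersion

theorem mainTheorem5 :
    (∀ P : Set Dispersion.Plane, Dispersion.IsFilledSquare P →
      ¬ ∃ (A : Dispersion.OnlineAlgorithm P) (σ : ℝ),
        σ < Real.sqrt (2 * (2 * Real.log 2 - 1) * Real.pi / Real.sqrt 3) ∧ A.IsCompetitive σ) ∧
    (1.183 : ℝ) < Real.sqrt (2 * (2 * Real.log 2 - 1) * Real.pi / Real.sqrt 3) ∧
    Real.sqrt (2 * (2 * Real.log 2 - 1) * Real.pi / Real.sqrt 3) < (1.184 : ℝ) := by
  have h3pos : 0 < Real.sqrt 3 := by positivity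
  have h3lo : (1.732 : ℝ) < Real.sqrt 3 := Real.lt_sqrt_of_sq_lt (by norm_num)
  have h3hi : Real.sqrt 3 < 1.7321 := (Real.sqrt_lt' (by norm_num)).2 (by norm_num)
  have hl1 := Real.log_two_gt_d9
  have hl2 := Real.log_two_lt_d9
  have hp1 := Real.pi_gt_d4
  have hp2 := Real.pi_lt_d4
  refine ⟨?_, ?_, ?_⟩
  · rintro P hP ⟨A, σ, hσ, hA⟩
    exact hσ.not_ge (hA.sqrt_le hP)
  · refine Real.lt_sqrt_of_sq_lt ?_
    rw [lt_div_iff₀ h3pos]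
    nlinarith [mul_le_mul (show (0.77258 : ℝ) ≤ 2 * (2 * Real.log 2 - 1) by linarith) hp1.le
      (by norm_num) (by linarith)]
  · rw [Real.sqrt_lt' (by norm_num), div_lt_iff₀ h3pos]
    nlinarith [mul_le_mul (show 2 * (2 * Real.log 2 - 1) ≤ (0.77259 : ℝ) by linarith) hp2.le
      Real.pi_pos.le (by norm_num)]
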